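/- Let $\rho\in(-1,1]$ and let $B_1,B_2$ be two independent standard Brownian motions. Let $(W_1(t),W_2(t))_{t\ge 0}$ be a pair of standard Brownian motions (with almost surely continuous paths) that has the same law as $(B_1(t),\ \rho B_1(t)+\sqrt{1-\rho^2}\,B_2(t))_{t\ge 0}$. For $c_1,c_2,u,v\in\mathbb{R}$ define the simultaneous ruin probability $$\psi(u,v)=P\big(\exists\, t\in[0,1]:\ W_1(t)-c_1t>u,\ W_2(t)-c_2t>v\big).$$ Then, for all $c_1,c_2\in\mathbb{R}$ and all $(u,v)\in\mathbb{R}^2\setminus(-\infty,0]^2$, the probability $P(W_1(1)>\max(c_1,0),\,W_2(1)>\max(c_2,0))$ is positive and $$P(W_1(1)>u+c_1,\,W_2(1)>v+c_2)\ \le\ \psi(u,v)\ \le\ \frac{P(W_1(1)>u+c_1,\,W_2(1)>v+c_2)}{P(W_1(1)>\max(c_1,0),\,W_2(1)>\max(c_2,0))}.$$ -/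

import Mathlib

open MeasureTheory ProbabilityTheory
open scoped NNReal

/-- The simultaneous ruin probability on the time horizon `[0, 1]`, with initial capitals `u`, `v`
and premium rates `c₁`, `c₂`:
the probability that `W₁ t - c₁ t > u` and `W₂ t - c₂ t > v` at one common time `t ∈ [0, 1]`. -/
noncomputable def simultaneousRuinProb {Ω : Type*} [MeasurableSpace Ω] (P : Measure Ω)
    (W₁ W₂ : ℝ≥0 → Ω → ℝ) (c₁ c₂ u v : ℝ) : ℝ :=
  P.real {ω | ∃ t : ℝ≥0, t ≤ 1 ∧ W₁ t ω - c₁ * t > u ∧ W₂ t ω - c₂ * t > v}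

/-! The lower bound takes `t = 1`. For the upper bound, stop at the first ruin time `t` in a finite
grid. If the increments over `[t, 1]` also exceed `cᵢ (1 - t)`, both components are ruined at time
1. These increments are independent of the past and distributed as `√(1 - t)` times the pair at time
1, so this has conditional probability at least `K = P (W₁ 1 > max c₁ 0, W₂ 1 > max c₂ 0)`. Summing
over the disjoint first-passage events (`measure_biUnion_mul_le_of_first_passage`) gives `P (ruin on
the grid) * K ≤ P (ruin at time 1)`. Path continuity makes the set of ruin times open, so finite
subsets of a dense sequence suffice (`measure_exists_le_of_forall_finset`). -/

/-- If `(f₁, g₁)` is independent of `(f₂, g₂)`, `f₁` of `g₁` and `f₂` of `g₂`, then `(f₁, f₂)` is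
independent of `(g₁, g₂)`. -/
lemma indepFun_prodMk_prodMk_of_indepFun {Ω α₁ α₂ β₁ β₂ : Type*} [MeasurableSpace Ω]
    [MeasurableSpace α₁] [MeasurableSpace α₂] [MeasurableSpace β₁] [MeasurableSpace β₂]
    {P : Measure Ω} [IsProbabilityMeasure P] {f₁ : Ω → α₁} {f₂ : Ω → α₂} {g₁ : Ω → β₁} {g₂ : Ω → β₂}
    (hf₁ : AEMeasurable f₁ P) (hf₂ : AEMeasurable f₂ P)
    (hg₁ : AEMeasurable g₁ P) (hg₂ : AEMeasurable g₂ P)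
    (h₁ : IndepFun f₁ g₁ P) (h₂ : IndepFun f₂ g₂ P)
    (h : IndepFun (fun ω ↦ (f₁ ω, g₁ ω)) (fun ω ↦ (f₂ ω, g₂ ω)) P) :
    IndepFun (fun ω ↦ (f₁ ω, f₂ ω)) (fun ω ↦ (g₁ ω, g₂ ω)) P := by
  have hf := hf₁.prodMk hf₂
  have hg := hg₁.prodMk hg₂
  have hf12 : IndepFun f₁ f₂ P := h.comp measurable_fst measurable_fst
  have hg12 : IndepFun g₁ g₂ P := h.comp measurable_snd measurable_snd
  have := Measure.isProbabilityMeasure_map (μ := P) hf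
  have := Measure.isProbabilityMeasure_map (μ := P) hg
  rw [indepFun_iff_map_prod_eq_prod_map_map hf hg]
  let spanf : (P.map fun ω ↦ (f₁ ω, f₂ ω)).FiniteSpanningSetsIn
      (Set.image2 (· ×ˢ ·) {s : Set α₁ | MeasurableSet s} {t : Set α₂ | MeasurableSet t}) :=
    ⟨fun _ ↦ Set.univ, fun _ ↦ ⟨_, .univ, _, .univ, Set.univ_prod_univ⟩,
      fun _ ↦ measure_lt_top _ _, Set.iUnion_const _⟩
  let spang : (P.map fun ω ↦ (g₁ ω, g₂ ω)).FiniteSpanningSetsIn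
      (Set.image2 (· ×ˢ ·) {s : Set β₁ | MeasurableSet s} {t : Set β₂ | MeasurableSet t}) :=
    ⟨fun _ ↦ Set.univ, fun _ ↦ ⟨_, .univ, _, .univ, Set.univ_prod_univ⟩,
      fun _ ↦ measure_lt_top _ _, Set.iUnion_const _⟩
  -- Measurable rectangles form generating π-systems, so the product formula need only be checked on
  -- them.
  refine (Measure.prod_eq_generateFrom generateFrom_prod generateFrom_prod isPiSystem_prod
    isPiSystem_prod spanf spang ?_).symm
  rintro _ ⟨s₁, hs₁, s₂, hs₂, rfl⟩ _ ⟨t₁, ht₁, t₂, ht₂, rfl⟩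
  simp only [Set.mem_ofPred_eq] at hs₁ hs₂ ht₁ ht₂
  rw [Measure.map_apply_of_aemeasurable (hf.prodMk hg) ((hs₁.prod hs₂).prod (ht₁.prod ht₂)),
    Measure.map_apply_of_aemeasurable hf (hs₁.prod hs₂),
    Measure.map_apply_of_aemeasurable hg (ht₁.prod ht₂)]
  have e := h.measure_inter_preimage_eq_mul _ _ (hs₁.prod ht₁) (hs₂.prod ht₂)
  simp only [Set.mk_preimage_prod] at e ⊢
  rw [h₁.measure_inter_preimage_eq_mul _ _ hs₁ ht₁,
    h₂.measure_inter_preimage_eq_mul _ _ hs₂ ht₂] at e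
  rw [hf12.measure_inter_preimage_eq_mul _ _ hs₁ hs₂,
    hg12.measure_inter_preimage_eq_mul _ _ ht₁ ht₂, Set.inter_inter_inter_comm, e]
  ring

/-- First passage decomposition over finitely many times: if, given that `A t` occurs and no earlier
event does, the event `G` has conditional probability at least `K`, then `P (⋃ t, A t) * K ≤ P G`. -/
lemma measure_biUnion_mul_le_of_first_passage {Ω ι : Type*} [MeasurableSpace Ω] [LinearOrder ι]
    {P : Measure Ω} (I : Finset ι) (A C : ι → Set Ω) (G : Set Ω) (K : ENNReal)
    (hA : ∀ t ∈ I, NullMeasurableSet (A t) P) (hC : ∀ t ∈ I, NullMeasurableSet (C t) P)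
    (hG : ∀ t ∈ I, A t ∩ C t ⊆ G)
    (hK : ∀ t ∈ I, P (A t \ ⋃ s ∈ I.filter (· < t), A s) * K ≤
      P ((A t \ ⋃ s ∈ I.filter (· < t), A s) ∩ C t)) :
    P (⋃ t ∈ I, A t) * K ≤ P G := by
  set D : ι → Set Ω := fun t ↦ A t \ ⋃ s ∈ I.filter (· < t), A s with hD
  have hU : ⋃ t ∈ I, A t ⊆ ⋃ t ∈ I, D t := by
    intro ω hω
    simp only [Set.mem_iUnion, exists_prop] at hω
    classical
    have hne : (I.filter (fun t ↦ ω ∈ A t)).Nonempty := by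
      obtain ⟨t, ht, hωt⟩ := hω
      exact ⟨t, by simp [ht, hωt]⟩
    obtain ⟨t, ht, hmin⟩ := Finset.exists_min_image _ id hne
    simp only [Finset.mem_filter, id, and_imp] at ht hmin
    simp only [Set.mem_iUnion, exists_prop, hD, Set.mem_sdiff, Finset.mem_filter, not_exists,
      not_and]
    exact ⟨t, ht.1, ht.2, fun s hs hωs ↦ (hmin s hs.1 hωs).not_gt hs.2⟩
  have hdisj : Set.PairwiseDisjoint (I : Set ι) (fun t ↦ D t ∩ C t) := by
    intro t ht s hs hts
    wlog h : t < s generalizing t s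
    · exact (this hs ht hts.symm (lt_of_le_of_ne (not_lt.1 h) hts.symm)).symm
    refine Set.disjoint_left.2 fun ω h1 h2 ↦ h2.1.2 ?_
    simp only [Set.mem_iUnion, Finset.mem_filter, exists_prop]
    exact ⟨t, ⟨ht, h⟩, h1.1.1⟩
  have hmeas : ∀ t ∈ I, NullMeasurableSet (D t ∩ C t) P := fun t ht ↦
    ((hA t ht).diff (.biUnion (Finset.countable_toSet _)
      fun s hs ↦ hA s (Finset.mem_of_mem_filter s hs))).inter (hC t ht)
  calc P (⋃ t ∈ I, A t) * K ≤ (∑ t ∈ I, P (D t)) * K := by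
        gcongr
        exact (measure_mono hU).trans (measure_biUnion_finset_le _ _)
    _ ≤ ∑ t ∈ I, P (D t ∩ C t) := by
        rw [Finset.sum_mul]
        exact Finset.sum_le_sum hK
    _ = P (⋃ t ∈ I, D t ∩ C t) :=
        (measure_biUnion_finset₀ (fun t ht s hs hts ↦ (hdisj ht hs hts).aedisjoint) hmeas).symm
    _ ≤ P G := measure_mono (Set.iUnion₂_subset fun t ht ω hω ↦ hG t ht ⟨hω.1.1, hω.2⟩)

lemma measurableSet_lt_and_lt {α : Type*} [MeasurableSpace α] {f g f' g' : α → ℝ}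
    (hf : Measurable f) (hg : Measurable g) (hf' : Measurable f') (hg' : Measurable g') :
    MeasurableSet {x | f x < g x ∧ f' x < g' x} :=
  (measurableSet_lt hf hg).inter (measurableSet_lt hf' hg')

lemma nullMeasurableSet_lt_and_lt {α : Type*} [MeasurableSpace α] {μ : Measure α}
    {f g f' g' : α → ℝ} (hf : AEMeasurable f μ) (hg : AEMeasurable g μ)
    (hf' : AEMeasurable f' μ) (hg' : AEMeasurable g' μ) :
    NullMeasurableSet {x | f x < g x ∧ f' x < g' x} μ :=
  (nullMeasurableSet_lt hf hg).inter (nullMeasurableSet_lt hf' hg')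

section CorrelatedBrownian

variable {Ω : Type*} [MeasurableSpace Ω] {P : Measure Ω} {B₁ B₂ : ℝ≥0 → Ω → ℝ}

/-- Joint increments of two independent Brownian motions are independent of the joint past. -/
lemma indepFun_increment_past [IsProbabilityMeasure P]
    (hB₁ : IsPreBrownianReal B₁ P) (hB₂ : IsPreBrownianReal B₂ P)
    (hB : IndepFun (fun ω t ↦ B₁ t ω) (fun ω t ↦ B₂ t ω) P) (t h : ℝ≥0) (I : Finset ℝ≥0)
    (hI : ∀ s ∈ I, s ≤ t) :
    IndepFun (fun ω ↦ (B₁ (t + h) ω - B₁ t ω, B₂ (t + h) ω - B₂ t ω))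
      (fun ω ↦ ((fun s : I ↦ B₁ s ω), (fun s : I ↦ B₂ s ω))) P := by
  have aux {B : ℝ≥0 → Ω → ℝ} (hB : IsPreBrownianReal B P) :
      IndepFun (fun ω ↦ B (t + h) ω - B t ω) (fun ω (s : I) ↦ B s ω) P :=
    (hB.indepFun_shift t).comp (φ := fun x : ℝ≥0 → ℝ ↦ x h)
      (ψ := fun (x : Set.Iic t → ℝ) (s : I) ↦ x ⟨s, hI s s.2⟩)
      (by fun_prop) (by fun_prop)
  have m {B : ℝ≥0 → Ω → ℝ} (hB : IsPreBrownianReal B P) :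
      AEMeasurable (fun ω (s : I) ↦ B s ω) P :=
    aemeasurable_pi_lambda _ fun s ↦ hB.aemeasurable s
  refine indepFun_prodMk_prodMk_of_indepFun
    ((hB₁.aemeasurable _).sub (hB₁.aemeasurable _)) ((hB₂.aemeasurable _).sub (hB₂.aemeasurable _))
    (m hB₁) (m hB₂) (aux hB₁) (aux hB₂) ?_
  exact hB.comp (φ := fun x : ℝ≥0 → ℝ ↦ (x (t + h) - x t, fun s : I ↦ x s))
    (ψ := fun x : ℝ≥0 → ℝ ↦ (x (t + h) - x t, fun s : I ↦ x s)) (by fun_prop) (by fun_prop)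

/-- Both variables are centred Gaussian with variance `h`. -/
lemma identDistrib_increment_sqrt_mul {B : ℝ≥0 → Ω → ℝ} (hB : IsPreBrownianReal B P) (t h : ℝ≥0) :
    IdentDistrib (fun ω ↦ B (t + h) ω - B t ω) (fun ω ↦ √(h : ℝ) * B 1 ω) P P := by
  refine ((hB.shift t).hasLaw_eval h).identDistrib ?_
  convert gaussianReal_const_mul (hB.hasLaw_eval 1) √(h : ℝ) using 2
  · simp
  · ext
    simp

/-- Brownian scaling for the joint increments of two independent Brownian motions. -/
lemma identDistrib_increments_sqrt_mul [IsProbabilityMeasure P]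
    (hB₁ : IsPreBrownianReal B₁ P)
    (hB₂ : IsPreBrownianReal B₂ P)
    (hB : IndepFun (fun ω t ↦ B₁ t ω) (fun ω t ↦ B₂ t ω) P) (t h : ℝ≥0) :
    IdentDistrib (fun ω ↦ (B₁ (t + h) ω - B₁ t ω, B₂ (t + h) ω - B₂ t ω))
      (fun ω ↦ (√(h : ℝ) * B₁ 1 ω, √(h : ℝ) * B₂ 1 ω)) P P :=
  (identDistrib_increment_sqrt_mul hB₁ t h).prodMk (identDistrib_increment_sqrt_mul hB₂ t h)
    (hB.comp (φ := fun x : ℝ≥0 → ℝ ↦ x (t + h) - x t) (ψ := fun x : ℝ≥0 → ℝ ↦ x (t + h) - x t)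
      (by fun_prop) (by fun_prop))
    (hB.comp (φ := fun x : ℝ≥0 → ℝ ↦ √(h : ℝ) * x 1) (ψ := fun x : ℝ≥0 → ℝ ↦ √(h : ℝ) * x 1)
      (by fun_prop) (by fun_prop))

/-- After dividing by `√h`, this is `c * √h ≤ max c 0 < x`, valid since `0 < √h ≤ 1`. The maximum
with 0 covers negative `c`. -/
lemma mul_lt_sqrt_mul_of_max_lt {c x h : ℝ} (h0 : 0 < h) (h1 : h ≤ 1) (hx : max c 0 < x) :
    c * h < √h * x := by
  have hs : 0 < √h := Real.sqrt_pos.2 h0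
  have hs1 : √h ≤ 1 := Real.sqrt_le_one.2 h1
  have hc : c < x := (le_max_left _ _).trans_lt hx
  have hx0 : 0 < x := (le_max_right _ _).trans_lt hx
  have e : c * h = √h * (c * √h) := by
    nth_rw 1 [← Real.mul_self_sqrt h0.le]
    ring
  rw [e]
  refine mul_lt_mul_of_pos_left ?_ hs
  nlinarith

/-- The increments over `[t, t + h]`, `0 < h ≤ 1`, exceed the lines of slopes `c₁`, `c₂` with
probability at least `P (X 1 > max c₁ 0, Y 1 > max c₂ 0)`, where `X = B₁`, `Y = ρ B₁ + σ B₂`. -/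
lemma measure_max_lt_le_increment [IsProbabilityMeasure P]
    (hB₁ : IsPreBrownianReal B₁ P) (hB₂ : IsPreBrownianReal B₂ P)
    (hB : IndepFun (fun ω t ↦ B₁ t ω) (fun ω t ↦ B₂ t ω) P) (ρ σ c₁ c₂ : ℝ) (t h : ℝ≥0)
    (h0 : 0 < h) (h1 : h ≤ 1) :
    P {ω | max c₁ 0 < B₁ 1 ω ∧ max c₂ 0 < ρ * B₁ 1 ω + σ * B₂ 1 ω} ≤
      P {ω | c₁ * h < B₁ (t + h) ω - B₁ t ω ∧
        c₂ * h < ρ * (B₁ (t + h) ω - B₁ t ω) + σ * (B₂ (t + h) ω - B₂ t ω)} := by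
  have hS : MeasurableSet {p : ℝ × ℝ | c₁ * h < p.1 ∧ c₂ * h < ρ * p.1 + σ * p.2} :=
    measurableSet_lt_and_lt (by fun_prop) (by fun_prop) (by fun_prop) (by fun_prop)
  have e := (identDistrib_increments_sqrt_mul hB₁ hB₂ hB t h).measure_mem_eq hS
  simp only [Set.preimage_ofPred_eq] at e
  rw [e]
  refine measure_mono fun ω hω ↦ ?_
  refine ⟨mul_lt_sqrt_mul_of_max_lt (by exact_mod_cast h0) (by exact_mod_cast h1) hω.1, ?_⟩
  have := mul_lt_sqrt_mul_of_max_lt (h := h) (by exact_mod_cast h0) (by exact_mod_cast h1) hω.2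
  linarith

/-- Upper bound for the probability of simultaneous ruin at one of finitely many times. -/
lemma measure_ruin_finset_mul_le [IsProbabilityMeasure P]
    (hB₁ : IsPreBrownianReal B₁ P) (hB₂ : IsPreBrownianReal B₂ P)
    (hB : IndepFun (fun ω t ↦ B₁ t ω) (fun ω t ↦ B₂ t ω) P) (ρ σ c₁ c₂ u v : ℝ)
    (I : Finset ℝ≥0) (hI : ∀ t ∈ I, t ≤ 1) :
    P (⋃ t ∈ I, {ω | B₁ t ω - c₁ * t > u ∧ ρ * B₁ t ω + σ * B₂ t ω - c₂ * t > v}) *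
        P {ω | max c₁ 0 < B₁ 1 ω ∧ max c₂ 0 < ρ * B₁ 1 ω + σ * B₂ 1 ω} ≤
      P {ω | B₁ 1 ω > u + c₁ ∧ ρ * B₁ 1 ω + σ * B₂ 1 ω > v + c₂} := by
  have m₁ := hB₁.aemeasurable
  have m₂ := hB₂.aemeasurable
  refine measure_biUnion_mul_le_of_first_passage I _
    -- The guard `t < 1` makes this the sure event at `t = 1`, where the strict inequalities would
    -- read `0 < 0`.
    (fun t ↦ {ω | t < 1 → c₁ * (1 - t) < B₁ 1 ω - B₁ t ω ∧
        c₂ * (1 - t) < ρ * (B₁ 1 ω - B₁ t ω) + σ * (B₂ 1 ω - B₂ t ω)}) _ _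
    (fun t _ ↦ ?_) (fun t _ ↦ ?_) (fun t ht ω hω ↦ ?_) (fun t ht ↦ ?_)
  · exact nullMeasurableSet_lt_and_lt (by fun_prop) (by fun_prop) (by fun_prop)
        (by fun_prop)
  · by_cases h : t < 1
    · simp only [h, true_imp_iff]
      exact nullMeasurableSet_lt_and_lt (by fun_prop) (by fun_prop) (by fun_prop)
        (by fun_prop)
    · simp [h]
  · obtain ⟨⟨h1, h2⟩, h3⟩ := hω
    rcases (hI t ht).lt_or_eq with h | rfl
    · obtain ⟨h4, h5⟩ := h3 h
      constructor <;> linarith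
    · simp only [NNReal.coe_one, mul_one] at h1 h2
      constructor <;> linarith
  · rcases (hI t ht).lt_or_eq with h | rfl
    swap
    · simpa using mul_le_of_le_one_right' prob_le_one
    simp only [h, true_imp_iff]
    have hadd : t + (1 - t) = 1 := add_tsub_cancel_of_le h.le
    have hsub : ((1 - t : ℝ≥0) : ℝ) = 1 - t := by rw [NNReal.coe_sub h.le, NNReal.coe_one]
    have hind := indepFun_increment_past hB₁ hB₂ hB t (1 - t) (I.filter (· ≤ t))
      (fun s hs ↦ (Finset.mem_filter.1 hs).2)
    have hbound := measure_max_lt_le_increment hB₁ hB₂ hB ρ σ c₁ c₂ t (1 - t)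
      (tsub_pos_of_lt h) tsub_le_self
    rw [hadd] at hind hbound
    rw [hsub] at hbound
    rw [Set.inter_comm, hind.meas_inter, mul_comm]
    · gcongr
    · exact ⟨{p | c₁ * (1 - t) < p.1 ∧ c₂ * (1 - t) < ρ * p.1 + σ * p.2},
        measurableSet_lt_and_lt (by fun_prop) (by fun_prop) (by fun_prop) (by fun_prop), rfl⟩
    -- First passage at `t` is determined by the grid values up to and including `t`.
    · have hA (s : ℝ≥0) (hs : s ∈ I.filter (· ≤ t)) :
          MeasurableSet[MeasurableSpace.comap (fun ω ↦ ((fun s : I.filter (· ≤ t) ↦ B₁ s ω),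
            (fun s : I.filter (· ≤ t) ↦ B₂ s ω))) inferInstance]
            {ω | B₁ s ω - c₁ * s > u ∧ ρ * B₁ s ω + σ * B₂ s ω - c₂ * s > v} :=
        ⟨{p | p.1 ⟨s, hs⟩ - c₁ * s > u ∧ ρ * p.1 ⟨s, hs⟩ + σ * p.2 ⟨s, hs⟩ - c₂ * s > v},
          measurableSet_lt_and_lt (by fun_prop) (by fun_prop) (by fun_prop) (by fun_prop), rfl⟩
      refine (hA t (by simp [ht])).diff (.biUnion (Finset.countable_toSet _) fun s hs ↦ hA s ?_)
      simp only [Finset.coe_filter, Set.mem_ofPred_eq] at hs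
      simp [hs.1, hs.2.le]

/-- The pair `(B₁ 1, ρ B₁ 1 + σ B₂ 1)` charges every quadrant `(a, ∞) × (b, ∞)`. -/
lemma measure_quadrant_pos (hB₁ : IsPreBrownianReal B₁ P) (hB₂ : IsPreBrownianReal B₂ P)
    (hB : IndepFun (fun ω t ↦ B₁ t ω) (fun ω t ↦ B₂ t ω) P) {ρ : ℝ} (hρ : ρ ∈ Set.Ioc (-1 : ℝ) 1)
    (a b : ℝ) :
    0 < P {ω | a < B₁ 1 ω ∧ b < ρ * B₁ 1 ω + √(1 - ρ ^ 2) * B₂ 1 ω} := by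
  have pos {B : ℝ≥0 → Ω → ℝ} (hB : IsPreBrownianReal B P) {S : Set ℝ} (hS : IsOpen S)
      (hne : S.Nonempty) : 0 < P (B 1 ⁻¹' S) := by
    have hl := hB.hasLaw_eval 1
    rw [← Measure.map_apply_of_aemeasurable hl.aemeasurable hS.measurableSet, hl.map_eq,
      pos_iff_ne_zero]
    exact fun h0 ↦ (hS.measure_pos volume hne).ne'
      (gaussianReal_absolutelyContinuous' 0 one_ne_zero h0)
  rcases hρ.2.lt_or_eq with h | rfl
  · have hσ : 0 < √(1 - ρ ^ 2) := Real.sqrt_pos.2 (by nlinarith [hρ.1])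
    set σ := √(1 - ρ ^ 2)
    have h12 : IndepFun (B₁ 1) (B₂ 1) P :=
      hB.comp (φ := fun x : ℝ≥0 → ℝ ↦ x 1) (ψ := fun x : ℝ≥0 → ℝ ↦ x 1) (by fun_prop) (by fun_prop)
    -- Confining `B₁ 1` to `(a, a + 1)` bounds `|ρ * B₁ 1|` by `|ρ| * (|a| + 1)`; the threshold for
    -- `B₂ 1` absorbs this and `b`.
    have hp := ENNReal.mul_pos (pos hB₁ (isOpen_Ioo (a := a) (b := a + 1)) (by simp)).ne'
      (pos hB₂ (isOpen_Ioi (a := (b + |ρ| * (|a| + 1)) / σ)) (by simp)).ne'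
    rw [← h12.measure_inter_preimage_eq_mul _ _ measurableSet_Ioo measurableSet_Ioi] at hp
    refine hp.trans_le (measure_mono fun ω hω ↦ ?_)
    obtain ⟨⟨h1, h2⟩, h3⟩ := hω
    refine ⟨h1, ?_⟩
    rw [Set.mem_preimage, Set.mem_Ioi, div_lt_iff₀ hσ] at h3
    have h4 : |B₁ 1 ω| ≤ |a| + 1 :=
      abs_le.2 ⟨by linarith [neg_abs_le a], by linarith [le_abs_self a]⟩
    have h5 : -(ρ * B₁ 1 ω) ≤ |ρ| * (|a| + 1) :=
      (neg_le_abs _).trans (abs_mul ρ _ ▸ mul_le_mul_of_nonneg_left h4 (abs_nonneg _))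
    linarith
  -- For `ρ = 1` both coordinates equal `B₁ 1`.
  · refine (pos hB₁ (isOpen_Ioi (a := max a b)) (by simp)).trans_le (measure_mono fun ω hω ↦ ?_)
    simpa using hω

end CorrelatedBrownian

/-- If almost surely the set of times `t` with `ω ∈ A t` is open in a separable space, then a bound
on the probability of `⋃ t ∈ I, A t` for all finite `I` also bounds that of `∃ t, ω ∈ A t`. -/
lemma measure_exists_le_of_forall_finset {Ω T : Type*} [MeasurableSpace Ω] [TopologicalSpace T]
    [TopologicalSpace.SeparableSpace T] [Nonempty T] {P : Measure Ω} {A : T → Set Ω} {C : ENNReal}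
    (hopen : ∀ᵐ ω ∂P, IsOpen {t | ω ∈ A t}) (h : ∀ I : Finset T, P (⋃ t ∈ I, A t) ≤ C) :
    P {ω | ∃ t, ω ∈ A t} ≤ C := by
  classical
  calc P {ω | ∃ t, ω ∈ A t} ≤ P (⋃ n, A (TopologicalSpace.denseSeq T n)) := by
        refine measure_mono_ae ?_
        filter_upwards [hopen] with ω hω ⟨t, ht⟩
        obtain ⟨n, hn⟩ :=
          (TopologicalSpace.denseRange_denseSeq T).exists_mem_open hω ⟨t, ht⟩
        exact Set.mem_iUnion.2 ⟨n, hn⟩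
    _ ≤ C := by
        rw [measure_iUnion_eq_iSup_accumulate]
        refine iSup_le fun n ↦ (measure_mono ?_).trans
          (h ((Finset.range (n + 1)).image (TopologicalSpace.denseSeq T)))
        intro ω hω
        obtain ⟨k, hk, hω⟩ := Set.mem_accumulate.1 hω
        simp only [Set.mem_iUnion, exists_prop]
        exact ⟨_, Finset.mem_image_of_mem _ (Finset.mem_range.2 (Nat.lt_succ_of_le hk)), hω⟩

theorem proposition1p1
    {Ω Ω' : Type*} [MeasurableSpace Ω] [MeasurableSpace Ω']
    (P : Measure Ω) [IsProbabilityMeasure P] (P' : Measure Ω') [IsProbabilityMeasure P']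
    (ρ : ℝ) (hρ : ρ ∈ Set.Ioc (-1 : ℝ) 1)
    -- two independent standard Brownian motions
    (B₁ B₂ : ℝ≥0 → Ω' → ℝ) (hB₁ : IsBrownianReal B₁ P') (hB₂ : IsBrownianReal B₂ P')
    (hB : IndepFun (fun ω t ↦ B₁ t ω) (fun ω t ↦ B₂ t ω) P')
    -- two standard Brownian motions whose joint law (all finite-dimensional distributions)
    -- is that of `(B₁, ρ B₁ + √(1 - ρ²) B₂)`
    (W₁ W₂ : ℝ≥0 → Ω → ℝ) (hW₁ : IsBrownianReal W₁ P) (hW₂ : IsBrownianReal W₂ P)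
    (hW : ∀ I : Finset ℝ≥0, IdentDistrib
      (fun ω (t : I) ↦ (W₁ t ω, W₂ t ω))
      (fun ω (t : I) ↦ (B₁ t ω, ρ * B₁ t ω + √(1 - ρ ^ 2) * B₂ t ω)) P P')
    (c₁ c₂ u v : ℝ) (huv : (u, v) ∉ Set.Iic (0 : ℝ) ×ˢ Set.Iic (0 : ℝ)) :
    P.real {ω | W₁ 1 ω > u + c₁ ∧ W₂ 1 ω > v + c₂} ≤ simultaneousRuinProb P W₁ W₂ c₁ c₂ u v ∧
    0 < P.real {ω | W₁ 1 ω > max c₁ 0 ∧ W₂ 1 ω > max c₂ 0} ∧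
    simultaneousRuinProb P W₁ W₂ c₁ c₂ u v ≤
      P.real {ω | W₁ 1 ω > u + c₁ ∧ W₂ 1 ω > v + c₂} /
        P.real {ω | W₁ 1 ω > max c₁ 0 ∧ W₂ 1 ω > max c₂ 0} := by
  have hone (a b : ℝ) : P {ω | W₁ 1 ω > a ∧ W₂ 1 ω > b} =
      P' {ω | B₁ 1 ω > a ∧ ρ * B₁ 1 ω + √(1 - ρ ^ 2) * B₂ 1 ω > b} := by
    have hS : MeasurableSet {p : ({1} : Finset ℝ≥0) → ℝ × ℝ |
        (p ⟨1, by simp⟩).1 > a ∧ (p ⟨1, by simp⟩).2 > b} :=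
      measurableSet_lt_and_lt (by fun_prop) (by fun_prop) (by fun_prop) (by fun_prop)
    exact (hW {1}).measure_mem_eq hS
  have hK : 0 < P {ω | W₁ 1 ω > max c₁ 0 ∧ W₂ 1 ω > max c₂ 0} := by
    rw [hone]
    exact measure_quadrant_pos hB₁.toIsPreBrownianReal hB₂.toIsPreBrownianReal hB hρ _ _
  refine ⟨?_, ENNReal.toReal_pos hK.ne' (measure_ne_top _ _), ?_⟩
  · refine measureReal_mono fun ω hω ↦ ⟨1, le_rfl, ?_, ?_⟩
    · simpa [lt_sub_iff_add_lt] using hω.1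
    · simpa [lt_sub_iff_add_lt] using hω.2
  · unfold simultaneousRuinProb Measure.real
    rw [← ENNReal.toReal_div]
    refine ENNReal.toReal_mono (ENNReal.div_ne_top (measure_ne_top _ _) hK.ne') ?_
    let A : Set.Iic (1 : ℝ≥0) → Set Ω :=
      fun t ↦ {ω | W₁ t ω - c₁ * (t : ℝ≥0) > u ∧ W₂ t ω - c₂ * (t : ℝ≥0) > v}
    refine (measure_mono (t := {ω | ∃ t, ω ∈ A t}) ?_).trans
      (measure_exists_le_of_forall_finset ?_ fun I ↦ ?_)
    · rintro ω ⟨t, ht, hω⟩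
      exact ⟨⟨t, ht⟩, hω⟩
    · filter_upwards [hW₁.cont, hW₂.cont] with ω h1 h2
      have hl (W : ℝ≥0 → Ω → ℝ) (c a : ℝ) (hc : Continuous (W · ω)) :
          IsOpen {t : Set.Iic (1 : ℝ≥0) | a < W t ω - c * (t : ℝ≥0)} :=
        isOpen_lt continuous_const ((hc.comp continuous_subtype_val).sub (by fun_prop))
      exact (hl W₁ c₁ u h1).inter (hl W₂ c₂ v h2)
    · rw [ENNReal.le_div_iff_mul_le (.inl hK.ne') (.inl (measure_ne_top _ _)), hone, hone]
      classical
      let J : Finset ℝ≥0 := I.image Subtype.val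
      have hJ : ∀ t ∈ J, t ≤ 1 := by
        intro t ht
        obtain ⟨s, -, rfl⟩ := Finset.mem_image.1 ht
        exact s.2
      refine le_of_eq_of_le ?_ (measure_ruin_finset_mul_le hB₁.toIsPreBrownianReal
        hB₂.toIsPreBrownianReal hB ρ √(1 - ρ ^ 2) c₁ c₂ u v J hJ)
      congr 1
      -- Ruin on the grid depends only on the marginal at the times in `J`, so its probability
      -- transfers from `W` to `B`.
      have hS : MeasurableSet (⋃ t : J, {p : J → ℝ × ℝ |
          (p t).1 - c₁ * (t : ℝ≥0) > u ∧ (p t).2 - c₂ * (t : ℝ≥0) > v}) :=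
        .iUnion fun t ↦ measurableSet_lt_and_lt (by fun_prop) (by fun_prop) (by fun_prop) (by fun_prop)
      convert (hW J).measure_mem_eq hS using 2
      · ext ω
        simp [A, J]
      · ext ω
        simp [J]
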